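/- Fix $n\ge 0$. A convex cone is a nonempty convex set closed under multiplication by nonnegative scalars. A convex process is a set-valued map $H:\mathbb{R}^n\rightrightarrows\mathbb{R}^n$ whose graph $\{(x,y): y\in H(x)\}$ is a convex cone in $\mathbb{R}^n\times\mathbb{R}^n$. A point $\xi\in\mathbb{R}^n$ is feasible for $H$ if there is an infinite sequence $(x_k)_{k\ge 0}$ with $x_0=\xi$ and $x_{k+1}\in H(x_k)$ for all $k\ge 0$; it is null-controllable for $H$ if there are $q\ge 0$ and $x_0,\dots,x_q\in\mathbb{R}^n$ with $x_0=\xi$, $x_q=0$ and $x_{k+1}\in H(x_k)$ for all $k<q$. The process $H$ is null-controllable if every feasible point is null-controllable. A set $\mathcal{D}\subseteq\mathbb{R}^n\times\mathbb{R}^n$ is informative for null-controllability if every convex process $H$ whose graph contains $\mathcal{D}$ is null-controllable. Theorem. Let $\mathcal{D}=\{(x_t,y_t): t=1,\dots,T\}\subseteq\mathbb{R}^n\times\mathbb{R}^n$ be a finite set, and put $X=[x_1\ \cdots\ x_T]$, $Y=[y_1\ \cdots\ y_T]\in\mathbb{R}^{n\times T}$. Let $\eta_1,\dots,\eta_\ell\in\mathbb{R}^{2n}$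 be vectors whose conic hull (the set of all combinations with nonnegative coefficients) is the positive polar cone $\mathcal{D}^+=\{\eta\in\mathbb{R}^{2n}: \langle d,\eta\rangle\ge 0 \text{ for all } d\in\mathcal{D}\}$, and let $Z,W\in\mathbb{R}^{\ell\times n}$ be defined by $\begin{bmatrix} Z & -W\end{bmatrix}=\begin{bmatrix}\eta_1&\cdots&\eta_\ell\end{bmatrix}^\top$. For a matrix $M$ and a set $S$, let $MS$ denote the image and $M^{-1}S=\{v: Mv\in S\}$ the inverse image; $(W^{-1}Z)^n\{0\}$ denotes the result of applying the map $S\mapsto W^{-1}(ZS)$ to the set $\{0\}$ $n$ times, and similarly for $(Z^{-1}W)^n\{0\}$ and $(YX^{-1})^n\{0\}$. Let $\mathbb{R}_+^T$ be the set of vectors in $\mathbb{R}^T$ with nonnegative entries. Suppose that \[X\mathbb{R}_+^T+(W^{-1}Z)^n\{0\}=\mathbb{R}^n\] and \[(YX^{-1})^n\{0\}=Y\mathbb{R}_+^T+(Z^{-1}W)^n\{0\}=\mathbb{R}^n.\] Then $\mathcal{D}$ is informative for null-controllability if and only if for every real $\lambda>0$ and every $\xi\in\mathbb{R}^n$, the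 (entrywise) inequality $\xi^\top(Y-\lambda X)\le 0$ implies $\xi=0$. -/

import Mathlib

open scoped Pointwise Matrix

namespace ConvProc

/-- A convex cone: a nonempty convex set that is closed under nonnegative scalar multiplication. -/
def IsConvexCone {V : Type*} [AddCommGroup V] [Module ℝ V] (C : Set V) : Prop :=
  C.Nonempty ∧ Convex ℝ C ∧ ∀ ρ : ℝ, 0 ≤ ρ → ∀ c ∈ C, ρ • c ∈ C

/-- A set-valued map from `ℝⁿ` to `ℝⁿ`. -/
abbrev SetValuedMap (n : ℕ) : Type := (Fin n → ℝ) → Set (Fin n → ℝ)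

namespace SetValuedMap

variable {n : ℕ}

/-- The graph of a set-valued map. -/
def graph (H : SetValuedMap n) : Set ((Fin n → ℝ) × (Fin n → ℝ)) :=
  {p | p.2 ∈ H p.1}

/-- A convex process is a set-valued map whose graph is a convex cone. -/
def IsConvexProc (H : SetValuedMap n) : Prop :=
  IsConvexCone H.graph

/-- The `q`-step behavior: all `x₀, …, x_q` with `x_{k+1} ∈ H(x_k)` for every `k < q`. -/
def finiteBehavior (H : SetValuedMap n) (q : ℕ) : Set (Fin (q + 1) → (Fin n → ℝ)) :=
  {x | ∀ k : Fin q, x k.succ ∈ H (x k.castSucc)}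

/-- The behavior: all infinite trajectories `x_{k+1} ∈ H(x_k)`, `k ≥ 0`. -/
def behavior (H : SetValuedMap n) : Set (ℕ → (Fin n → ℝ)) :=
  {x | ∀ k : ℕ, x (k + 1) ∈ H (x k)}

/-- The null-controllable set: the points that a finite trajectory steers to the origin. -/
def nullControllableSet (H : SetValuedMap n) : Set (Fin n → ℝ) :=
  {ξ | ∃ q : ℕ, ∃ x ∈ H.finiteBehavior q, x 0 = ξ ∧ x (Fin.last q) = 0}

/-- The feasible set: the points from which an infinite trajectory emanates. -/
def feasibleSet (H : SetValuedMap n) : Set (Fin n → ℝ) :=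
  {ξ | ∃ x ∈ H.behavior, x 0 = ξ}

/-- `H` is null-controllable if every feasible state is null-controllable. -/
def IsNullControllable (H : SetValuedMap n) : Prop :=
  H.feasibleSet ⊆ H.nullControllableSet

end SetValuedMap

/-- The data `D` are informative for null-controllability if every convex process that is
compatible with `D` (its graph contains `D`) is null-controllable. -/
def InformativeForNullControllability {n : ℕ} (D : Set ((Fin n → ℝ) × (Fin n → ℝ))) : Prop :=
  ∀ H : SetValuedMap n, H.IsConvexProc → D ⊆ H.graph → H.IsNullControllable

/-- The positive polar cone in `ℝⁿ × ℝⁿ`, for the standard inner product. -/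
def positivePolar {n : ℕ} (C : Set ((Fin n → ℝ) × (Fin n → ℝ))) :
    Set ((Fin n → ℝ) × (Fin n → ℝ)) :=
  {η | ∀ p ∈ C, 0 ≤ p.1 ⬝ᵥ η.1 + p.2 ⬝ᵥ η.2}

/-- The conic hull: all conic combinations of elements of `S`. -/
def cone {V : Type*} [AddCommGroup V] [Module ℝ V] (S : Set V) : Set V :=
  (PointedCone.hull ℝ S : Set V)

/-- The image `M S` of a set under a matrix. -/
def image {k l : ℕ} (M : Matrix (Fin k) (Fin l) ℝ) (S : Set (Fin l → ℝ)) : Set (Fin k → ℝ) :=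
  (fun v => M *ᵥ v) '' S

/-- The inverse image `M⁻¹ S` of a set under a matrix (which need not be invertible). -/
def preimage {k l : ℕ} (M : Matrix (Fin k) (Fin l) ℝ) (S : Set (Fin k → ℝ)) : Set (Fin l → ℝ) :=
  (fun v => M *ᵥ v) ⁻¹' S

/-- The nonnegative orthant of `ℝᵏ`. -/
def nonnegOrthant (k : ℕ) : Set (Fin k → ℝ) := {v | ∀ i, 0 ≤ v i}

end ConvProc

/-! Necessity: if a nonzero `ξ` satisfies the inequality for some `λ > 0`, the half space `ξ·y ≤ λ
ξ·x` is the graph of a process containing the data. The point `-ξ` is feasible along `λ^k (-ξ)`, but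
`ξ` stays negative on every trajectory from there, so none reaches the origin.

Sufficiency: let `K` be the graph of a compatible process. By Farkas the linear relation `L = {Zx =
Wy}` lies in the conic hull of the data, hence in `K`. Let `R` be the space reachable from 0 under
`L` in `n` steps, and `M` the sum of `R` and the null-controllable cone. If `M` is the whole space,
every feasible point is null-controllable: the state after `n` steps can be corrected into the
null-controllable cone by subtracting an `L`-trajectory that starts at 0.

That `M` is everything follows by duality (`eq_top_of_backwardInvariant`). Backward invariance of
`M` under `K` makes the adjoint process map the polar cone of `M` into itself with nonempty values
(`exists_mem_adjointOn`). On the annihilator of `M` the adjoint restricts to a linear bijection, so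
reachability of the linear hull of `K` forces the annihilator to vanish. Thus `M` has interior. If
`M` were proper, its polar would be a nonzero pointed closed cone, and the Krein–Rutman theorem
(`exists_eigenvector`) would give an adjoint eigenvector, which the spectral condition excludes. -/

namespace ConvProc

/-! ### Cones in real vector spaces: Farkas, separation, Krein–Rutman -/

/-- **Farkas' lemma** for a finite family of vectors. -/
theorem mem_hull_or_exists_separating {ι E : Type*} [AddCommGroup E] [Module ℝ E] (s : Finset ι) :
    ∀ (w : ι → E) (v : E), v ∈ PointedCone.hull ℝ (w '' s) ∨
      ∃ f : E →ₗ[ℝ] ℝ, (∀ i ∈ s, 0 ≤ f (w i)) ∧ f v < 0 := by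
  classical
  induction s using Finset.induction_on with
  | empty =>
    intro w v
    by_cases hv : v = 0
    · left; subst hv; exact Submodule.zero_mem _
    · right
      obtain ⟨f, hf⟩ := Module.Projective.exists_dual_eq_one ℝ hv
      exact ⟨-f, by simp, by simp [hf]⟩
  | insert a s ha ih =>
    intro w v
    rcases ih w v with h | ⟨f, hf, hfv⟩
    · exact Or.inl (Submodule.span_mono (Set.image_mono (by simp)) h)
    by_cases hfa : 0 ≤ f (w a)
    · refine Or.inr ⟨f, fun i hi => ?_, hfv⟩
      rcases Finset.mem_insert.1 hi with rfl | hi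
      exacts [hfa, hf i hi]
    push Not at hfa
    -- Projection along `w a` onto the kernel of `f`; a functional composed with it vanishes at `w
    -- a`.
    let π : E →ₗ[ℝ] E := LinearMap.id - ((f (w a))⁻¹ • f).smulRight (w a)
    have hπ : ∀ x, π x = x - ((f (w a))⁻¹ * f x) • w a := fun x => by simp [π]
    rcases ih (fun i => π (w i)) (π v) with h | ⟨g, hg, hgv⟩
    · left
      have hmem : w a ∈ PointedCone.hull ℝ (w '' ↑(insert a s)) :=
        Submodule.subset_span ⟨a, by simp, rfl⟩
      -- The lift `y` keeps `f y ≥ 0`; with `f v < 0` and `f (w a) < 0` this makes the coefficient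
      -- of `w a` in `v - y` nonnegative.
      have key : ∀ x ∈ PointedCone.hull ℝ ((fun i => π (w i)) '' ↑s),
          ∃ y ∈ PointedCone.hull ℝ (w '' ↑s), π y = x ∧ 0 ≤ f y := by
        intro x hx
        induction hx using Submodule.span_induction with
        | mem x hx =>
          obtain ⟨i, hi, rfl⟩ := hx
          exact ⟨w i, Submodule.subset_span ⟨i, hi, rfl⟩, rfl, hf i hi⟩
        | zero => exact ⟨0, Submodule.zero_mem _, by simp, by simp⟩
        | add x y _ _ hx hy =>
          obtain ⟨x', h1, rfl, h2⟩ := hx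
          obtain ⟨y', h3, rfl, h4⟩ := hy
          exact ⟨x' + y', Submodule.add_mem _ h1 h3, by simp, by rw [map_add]; positivity⟩
        | smul c x _ hx =>
          obtain ⟨x', h1, rfl, h2⟩ := hx
          refine ⟨(c : ℝ) • x', Submodule.smul_mem _ c h1, by rw [map_smul]; rfl, ?_⟩
          rw [map_smul]; exact mul_nonneg c.2 h2
      obtain ⟨y, hy, hyv, hfy⟩ := key _ h
      rw [hπ, hπ] at hyv
      have hinv : (f (w a))⁻¹ < 0 := inv_lt_zero.2 hfa
      have : v = y + ((f (w a))⁻¹ * (f v - f y)) • w a := by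
        rw [mul_sub, sub_smul]
        calc v = _ := sub_eq_iff_eq_add.1 hyv.symm
          _ = _ := by abel
      rw [this]
      refine Submodule.add_mem _ (Submodule.span_mono (Set.image_mono (by simp)) hy) ?_
      exact PointedCone.smul_mem _ (by nlinarith) hmem
    · refine Or.inr ⟨g ∘ₗ π, fun i hi => ?_, hgv⟩
      rcases Finset.mem_insert.1 hi with rfl | hi
      · have : π (w i) = 0 := by rw [hπ, inv_mul_cancel₀ hfa.ne]; simp
        simp [this]
      · exact hg i hi

/-- A convex cone in finite dimension has a point in its algebraic relative interior. -/
theorem exists_orderUnit {E : Type*} [AddCommGroup E] [Module ℝ E] [FiniteDimensional ℝ E]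
    (C : PointedCone ℝ E) :
    ∃ e ∈ C, ∀ x ∈ Submodule.span ℝ (C : Set E), ∃ δ : ℝ, 0 < δ ∧ e + δ • x ∈ C := by
  obtain ⟨s, hsC, hs⟩ := (Submodule.fg_span_iff_fg_span_finset_subset (R := ℝ) (C : Set E)).1
    (IsNoetherian.noetherian _)
  -- The sum of a finite subset of `C` spanning its linear hull: a small perturbation keeps all
  -- coefficients nonnegative.
  refine ⟨∑ i ∈ s, i, Submodule.sum_mem _ fun i hi => hsC hi, fun x hx => ?_⟩
  rw [hs, Submodule.mem_span_finset] at hx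
  obtain ⟨c, -, rfl⟩ := hx
  have hpos : 0 < 1 + ∑ i ∈ s, |c i| := by positivity
  refine ⟨(1 + ∑ i ∈ s, |c i|)⁻¹, by positivity, ?_⟩
  rw [Finset.smul_sum, ← Finset.sum_add_distrib]
  refine Submodule.sum_mem _ fun i hi => ?_
  have h1 : |c i| ≤ ∑ i ∈ s, |c i| :=
    Finset.single_le_sum (f := fun i => |c i|) (fun _ _ => abs_nonneg _) hi
  have : i + (1 + ∑ i ∈ s, |c i|)⁻¹ • c i • i = (1 + (1 + ∑ i ∈ s, |c i|)⁻¹ * c i) • i := by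
    module
  rw [this]
  refine PointedCone.smul_mem _ ?_ (hsC hi)
  have h2 : (1 + ∑ i ∈ s, |c i|)⁻¹ * |c i| ≤ 1 := by
    rw [inv_mul_le_iff₀ hpos]; linarith
  have h3 : (1 + ∑ i ∈ s, |c i|)⁻¹ * (-|c i|) ≤ (1 + ∑ i ∈ s, |c i|)⁻¹ * c i :=
    mul_le_mul_of_nonneg_left (neg_abs_le _) (by positivity)
  linarith

/-- An algebraic interior point of a proper convex cone is separated from the opposite cone. -/
theorem exists_nonneg_functional {E : Type*} [AddCommGroup E] [Module ℝ E]
    (C : PointedCone ℝ E) {e : E} (he : e ∈ C) (hint : ∀ x, ∃ δ : ℝ, 0 < δ ∧ e + δ • x ∈ C)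
    (hneg : -e ∉ C) : ∃ g : E →ₗ[ℝ] ℝ, (∀ x ∈ C, 0 ≤ g x) ∧ g e = 1 := by
  have he0 : e ≠ 0 := by rintro rfl; simp at hneg
  have hmem : ∀ t : ℝ, t • e ∈ C → 0 ≤ t := by
    intro t ht
    by_contra! hlt
    apply hneg
    have := PointedCone.smul_mem C (inv_nonneg.2 (neg_nonneg.2 hlt.le)) ht
    rwa [smul_smul, inv_neg, neg_mul, inv_mul_cancel₀ hlt.ne, neg_one_smul] at this
  -- The functional `t • e ↦ t` is nonnegative on `C` because `-e ∉ C`; the interior property of `e`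
  -- is the cofinality that Riesz extension needs.
  obtain ⟨g, hg, hgC⟩ := riesz_extension C (LinearPMap.mkSpanSingleton e (1 : ℝ) he0) (by
    rintro ⟨x, hx⟩ hxC
    obtain ⟨t, rfl⟩ := Submodule.mem_span_singleton.1 hx
    have := LinearPMap.mkSpanSingleton'_apply e (1 : ℝ)
      (fun c hc => by simp [(smul_eq_zero.1 hc).resolve_right he0]) t hx
    exact (hmem t hxC).trans_eq (by simpa using this.symm)) (by
    intro y
    obtain ⟨δ, hδ, h⟩ := hint y
    refine ⟨⟨δ⁻¹ • e, Submodule.mem_span_singleton.2 ⟨_, rfl⟩⟩, ?_⟩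
    have := PointedCone.smul_mem C (inv_nonneg.2 hδ.le) h
    rwa [smul_add, inv_smul_smul₀ hδ.ne'] at this)
  refine ⟨g, hgC, ?_⟩
  have := hg ⟨e, Submodule.mem_span_singleton_self e⟩
  rw [this]
  exact LinearPMap.mkSpanSingleton_apply ..

/-- **Krein–Rutman theorem for convex processes**: a closed convex process that maps a closed
pointed cone into itself, with nonempty values, has an eigenvector in that cone. -/
theorem exists_eigenvector {E : Type*} [NormedAddCommGroup E] [NormedSpace ℝ E]
    [FiniteDimensional ℝ E] (P : PointedCone ℝ E) (hP : IsClosed (P : Set E)) (φ : E →ₗ[ℝ] ℝ)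
    (hφ : ∀ p ∈ P, p ≠ 0 → 0 < φ p) (G : PointedCone ℝ (E × E)) (hG : IsClosed (G : Set (E × E)))
    (hGP : ∀ p q, (p, q) ∈ G → p ∈ P ∧ q ∈ P) (hdom : ∀ p ∈ P, ∃ q, (p, q) ∈ G)
    (h0 : ∀ q, (0, q) ∈ G → q = 0) (hne : ∃ p ∈ P, p ≠ 0) :
    ∃ p ∈ P, p ≠ 0 ∧ ∃ μ : ℝ, 0 ≤ μ ∧ (p, μ • p) ∈ G := by
  have hφc : Continuous φ := φ.continuous_of_finiteDimensional
  have hφ0 : ∀ p ∈ P, 0 ≤ φ p := fun p hp => by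
    rcases eq_or_ne p 0 with rfl | h
    · simp
    · exact (hφ p hp h).le
  have : ProperSpace E := FiniteDimensional.proper ℝ E
  -- boundedness of the sublevel sets of `φ` in `P`
  obtain ⟨b, hb, hbP⟩ : ∃ b : ℝ, 0 < b ∧ ∀ p ∈ P, b * ‖p‖ ≤ φ p := by
    obtain ⟨b, hb, h⟩ := ((isCompact_sphere (0 : E) 1).inter_right hP).exists_forall_le'
      (f := φ) hφc.continuousOn (a := 0) (by
        rintro p ⟨hp1, hp⟩
        exact hφ p hp (by rintro rfl; simp at hp1))
    refine ⟨b, hb, fun p hp => ?_⟩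
    rcases eq_or_ne p 0 with rfl | hp0
    · simp
    have hn : 0 < ‖p‖ := norm_pos_iff.2 hp0
    have := h (‖p‖⁻¹ • p) ⟨by simp [norm_smul, hn.ne'], PointedCone.smul_mem P (by positivity) hp⟩
    rw [map_smul, smul_eq_mul, inv_mul_eq_div, le_div_iff₀ hn] at this
    exact this
  have hcomp : ∀ c : ℝ, IsCompact {p | p ∈ P ∧ φ p ≤ c} := by
    intro c
    refine (isCompact_closedBall (0 : E) (c / b)).of_isClosed_subset
      (hP.inter (isClosed_le hφc continuous_const)) ?_
    rintro p ⟨hp, hpc⟩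
    rw [mem_closedBall_zero_iff, le_div_iff₀ hb, mul_comm]
    exact (hbP p hp).trans hpc
  obtain ⟨c, hc, hGc⟩ : ∃ c : ℝ, 0 < c ∧ ∀ p q, (p, q) ∈ G → φ q ≤ c * φ p := by
    have hK : IsCompact {x : E × E | x ∈ G ∧ φ x.2 = 1 ∧ φ x.1 ≤ 1} := by
      refine ((hcomp 1).prod (hcomp 1)).of_isClosed_subset
        (hG.inter ((isClosed_eq (hφc.comp continuous_snd) continuous_const).inter
          (isClosed_le (hφc.comp continuous_fst) continuous_const))) ?_
      rintro ⟨p, q⟩ ⟨h1, h2, h3⟩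
      exact ⟨⟨(hGP p q h1).1, h3⟩, ⟨(hGP p q h1).2, h2.le⟩⟩
    obtain ⟨a, ha, h⟩ := hK.exists_forall_le' (f := fun x => φ x.1)
      (hφc.comp continuous_fst).continuousOn (a := 0) (by
        rintro ⟨p, q⟩ ⟨h1, h2, -⟩
        refine hφ p (hGP p q h1).1 ?_
        rintro rfl
        rw [h0 q h1] at h2
        simp at h2)
    -- The term 1 covers pairs with `φ q ≤ φ p`; all others scale into the compact set, where `φ p ≥
    -- a`.
    refine ⟨1 + a⁻¹, by positivity, fun p q hpq => ?_⟩
    have hp := hφ0 p (hGP p q hpq).1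
    have hq := hφ0 q (hGP p q hpq).2
    by_contra! hlt
    have hq' : 0 < φ q := lt_of_le_of_lt (by positivity) hlt
    have hple : φ p ≤ φ q := by
      have : 0 ≤ a⁻¹ * φ p := by positivity
      linarith
    have h1 := h ((φ q)⁻¹ • (p, q)) ⟨PointedCone.smul_mem G (by positivity) hpq,
      by simp [hq'.ne'], by
        simp only [Prod.smul_fst, map_smul, smul_eq_mul]
        rwa [inv_mul_le_iff₀ hq', mul_one]⟩
    simp only [Prod.smul_fst, map_smul, smul_eq_mul] at h1
    rw [inv_mul_eq_div, le_div_iff₀ hq'] at h1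
    have h2 : φ q ≤ a⁻¹ * φ p := by
      rwa [inv_mul_eq_div, le_div_iff₀ ha, mul_comm]
    linarith
  obtain ⟨e, he, hunit⟩ := exists_orderUnit P
  have hunit' : ∀ x ∈ P, ∃ δ : ℝ, 0 < δ ∧ e - δ • x ∈ P := fun x hx => by
    obtain ⟨δ, h1, h2⟩ := hunit (-x) (Submodule.neg_mem _ (Submodule.subset_span hx))
    exact ⟨δ, h1, by simpa [sub_eq_add_neg] using h2⟩
  obtain ⟨p₁, hp₁, hp₁1⟩ : ∃ p ∈ P, φ p = 1 := by
    obtain ⟨p, hp, hp0⟩ := hne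
    have := hφ p hp hp0
    exact ⟨(φ p)⁻¹ • p, PointedCone.smul_mem P (by positivity) hp, by simp [this.ne']⟩
  have he0 : 0 < φ e := by
    refine hφ e he ?_
    rintro rfl
    obtain ⟨δ, h1, h2⟩ := hunit' p₁ hp₁
    have := hφ0 _ h2
    simp [hp₁1] at this
    linarith
  set C : ℝ := c + φ e with hC
  -- eigenvectors of the perturbed processes
  have hpert : ∀ ε : ℝ, 0 < ε → ε ≤ 1 →
      ∃ p μ, p ∈ P ∧ φ p = 1 ∧ 0 ≤ μ ∧ μ ≤ C ∧ (p, μ • p - ε • e) ∈ G := by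
    intro ε hε hε1
    -- Maximise `μ` subject to `q + ε • e - μ • p ∈ P` on the slice `φ p = 1`. At a maximum the
    -- residual `r` must vanish, which is the perturbed eigenvalue equation.
    let S : Set ((E × E) × ℝ) := {x | x.1 ∈ G ∧ φ x.1.1 = 1 ∧ 0 ≤ x.2 ∧
      x.1.2 + ε • e - x.2 • x.1.1 ∈ P}
    have hbd : ∀ x ∈ S, φ x.1.2 ≤ c ∧ x.2 ≤ C := by
      rintro ⟨⟨p, q⟩, μ⟩ ⟨h1, h2, h3, h4⟩
      have h5 := hGc p q h1
      have h6 := hφ0 _ h4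
      simp only [map_sub, map_add, map_smul, smul_eq_mul] at h2 h5 h6 ⊢
      rw [h2] at h5 h6
      have : ε * φ e ≤ 1 * φ e := mul_le_mul_of_nonneg_right hε1 he0.le
      constructor <;> linarith
    have hS : IsCompact S := by
      refine (((hcomp 1).prod (hcomp c)).prod (isCompact_Icc (a := 0) (b := C))).of_isClosed_subset
        ((hG.preimage continuous_fst).inter ((isClosed_eq (by fun_prop) continuous_const).inter
          ((isClosed_le continuous_const continuous_snd).inter
            (hP.preimage (f := fun x : (E × E) × ℝ => x.1.2 + ε • e - x.2 • x.1.1)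
              (by fun_prop))))) ?_
      intro x hx
      have h := hbd x hx
      obtain ⟨h1, h2, h3, h4⟩ := hx
      exact ⟨⟨⟨(hGP _ _ h1).1, h2.le⟩, ⟨(hGP _ _ h1).2, h.1⟩⟩, ⟨h3, h.2⟩⟩
    have hSne : S.Nonempty := by
      obtain ⟨q, hq⟩ := hdom p₁ hp₁
      refine ⟨((p₁, q), 0), hq, hp₁1, le_rfl, ?_⟩
      simpa using Submodule.add_mem P (hGP _ _ hq).2 (PointedCone.smul_mem P hε.le he)
    obtain ⟨⟨⟨p, q⟩, μ⟩, hxS, hmax⟩ := hS.exists_isMaxOn hSne continuous_snd.continuousOn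
    have hμC := (hbd _ hxS).2
    obtain ⟨hpq, hp1, hμ, hr⟩ := hxS
    simp only at hpq hp1 hμ hr hμC
    obtain ⟨hp, hq⟩ := hGP _ _ hpq
    set r : E := q + ε • e - μ • p with hr_def
    rcases eq_or_ne r 0 with hr0 | hr0
    · refine ⟨p, μ, hp, hp1, hμ, hμC, ?_⟩
      have : μ • p - ε • e = q := by
        rw [← sub_eq_zero.1 hr0, add_sub_cancel_right]
      rwa [this]
    · exfalso
      obtain ⟨f, hf⟩ := hdom r hr
      have hφr := hφ r hr hr0
      -- Here `p' = q + ε • e`. A nonzero residual leaves a surplus `(ε * φ r) • e` at `p'`, and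
      -- since `e - δ • p' ∈ P` this raises `μ` by `ε * φ r * δ`.
      set p' : E := μ • p + r with hp'
      have hφp' : φ p' = μ + φ r := by simp [hp', hp1]
      have hpos : 0 < φ p' := by rw [hφp']; linarith
      have hp'P : p' ∈ P := Submodule.add_mem P (PointedCone.smul_mem P hμ hp) hr
      obtain ⟨δ, hδ, hδP⟩ := hunit' p' hp'P
      have hG' : (p', μ • q + f) ∈ G := by
        have := Submodule.add_mem G (PointedCone.smul_mem G hμ hpq) hf
        simpa using this
      have hmem : (μ • q + f) + (ε * φ p') • e - (μ + ε * φ r * δ) • p' ∈ P := by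
        have h1 : (μ • q + f) + (ε * φ p') • e - (μ + ε * φ r * δ) • p' =
            f + (ε * φ r) • (e - δ • p') := by
          rw [hφp', hp', hr_def]; module
        rw [h1]
        exact Submodule.add_mem P (hGP _ _ hf).2 (PointedCone.smul_mem P (by positivity) hδP)
      have hnew : (((φ p')⁻¹ • (p', μ • q + f)), μ + ε * φ r * δ) ∈ S := by
        refine ⟨PointedCone.smul_mem G (by positivity) hG', by simp [hpos.ne'], by positivity, ?_⟩
        have := PointedCone.smul_mem P (inv_nonneg.2 hpos.le) hmem
        have h2 : (φ p')⁻¹ • ((μ • q + f) + (ε * φ p') • e - (μ + ε * φ r * δ) • p') =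
            (φ p')⁻¹ • (μ • q + f) + ε • e - (μ + ε * φ r * δ) • (φ p')⁻¹ • p' := by
          have h3 : ε • e = (φ p')⁻¹ • (ε * φ p') • e := by
            rw [smul_smul]; congr 1; field_simp
          rw [h3]; module
        rw [h2] at this
        exact this
      have := hmax hnew
      simp only [Set.mem_ofPred_eq] at this
      have : 0 < ε * φ r * δ := by positivity
      linarith
  -- passage to the limit
  let Q : Set ((E × ℝ) × ℝ) := ((({p | p ∈ P ∧ φ p ≤ 1} ×ˢ Set.Icc 0 C) ×ˢ Set.Icc 0 1) ∩
    {x | φ x.1.1 = 1}) ∩ (fun x => (x.1.1, x.1.2 • x.1.1 - x.2 • e)) ⁻¹' (G : Set (E × E))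
  have hQ : IsCompact Q :=
    ((((hcomp 1).prod isCompact_Icc).prod isCompact_Icc).inter_right
      (isClosed_eq (by fun_prop) continuous_const)).inter_right (hG.preimage (by fun_prop))
  have hclosed : IsClosed (Prod.snd '' Q) := (hQ.image continuous_snd).isClosed
  have hsub : Set.Ioo (0 : ℝ) 1 ⊆ Prod.snd '' Q := by
    rintro ε ⟨hε, hε1⟩
    obtain ⟨p, μ, h1, h2, h3, h4, h5⟩ := hpert ε hε hε1.le
    exact ⟨((p, μ), ε), ⟨⟨⟨⟨⟨h1, h2.le⟩, h3, h4⟩, hε.le, hε1.le⟩, h2⟩, h5⟩, rfl⟩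
  have hzero : (0 : ℝ) ∈ Prod.snd '' Q := by
    apply hclosed.closure_subset_iff.2 hsub
    rw [closure_Ioo zero_ne_one]
    simp
  obtain ⟨⟨⟨p, μ⟩, ε⟩, ⟨⟨⟨⟨⟨h1, -⟩, h3, -⟩, -⟩, h2⟩, h7⟩, h8⟩ := hzero
  simp only [Set.mem_preimage, Set.mem_ofPred_eq] at h1 h2 h3 h7 h8
  subst h8
  refine ⟨p, h1, ?_, μ, h3, by simpa using h7⟩
  rintro rfl
  simp at h2

end ConvProc

/-! ### Polar cones and adjoint processes -/

namespace ConvProc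

variable {n : ℕ}

/-- The positive polar cone of a convex cone in `ℝⁿ`. -/
def polar (M : PointedCone ℝ (Fin n → ℝ)) : PointedCone ℝ (Fin n → ℝ) where
  carrier := {p | ∀ m ∈ M, 0 ≤ m ⬝ᵥ p}
  zero_mem' := by simp
  add_mem' {p q} hp hq m hm := by
    rw [dotProduct_add]; exact add_nonneg (hp m hm) (hq m hm)
  smul_mem' c p hp m hm := by
    change 0 ≤ m ⬝ᵥ ((c : ℝ) • p)
    rw [dotProduct_smul]; exact mul_nonneg c.2 (hp m hm)

/-- The pairs `(p, q)` of the polar cone of `M` such that `p` belongs to the image of `q` under the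
adjoint of the convex process with graph `K`. -/
def adjointOn (K : PointedCone ℝ ((Fin n → ℝ) × (Fin n → ℝ))) (M : PointedCone ℝ (Fin n → ℝ)) :
    PointedCone ℝ ((Fin n → ℝ) × (Fin n → ℝ)) where
  carrier := {x | x.1 ∈ polar M ∧ x.2 ∈ polar M ∧ ∀ z ∈ K, z.2 ⬝ᵥ x.2 ≤ z.1 ⬝ᵥ x.1}
  zero_mem' := ⟨Submodule.zero_mem _, Submodule.zero_mem _, by simp⟩
  add_mem' {x y} hx hy := ⟨Submodule.add_mem _ hx.1 hy.1, Submodule.add_mem _ hx.2.1 hy.2.1,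
    fun z hz => by
      simp only [Prod.snd_add, Prod.fst_add, dotProduct_add]
      exact add_le_add (hx.2.2 z hz) (hy.2.2 z hz)⟩
  smul_mem' c x hx := ⟨Submodule.smul_mem _ c hx.1, Submodule.smul_mem _ c hx.2.1,
    fun z hz => by
      change z.2 ⬝ᵥ ((c : ℝ) • x.2) ≤ z.1 ⬝ᵥ ((c : ℝ) • x.1)
      rw [dotProduct_smul, dotProduct_smul]
      exact mul_le_mul_of_nonneg_left (hx.2.2 z hz) c.2⟩

theorem mem_adjointOn {K : PointedCone ℝ ((Fin n → ℝ) × (Fin n → ℝ))}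
    {M : PointedCone ℝ (Fin n → ℝ)} {p q : Fin n → ℝ} :
    (p, q) ∈ adjointOn K M ↔
      p ∈ polar M ∧ q ∈ polar M ∧ ∀ x y, (x, y) ∈ K → y ⬝ᵥ q ≤ x ⬝ᵥ p :=
  ⟨fun h => ⟨h.1, h.2.1, fun x y => h.2.2 (x, y)⟩, fun h => ⟨h.1, h.2.1, fun z => h.2.2 z.1 z.2⟩⟩

theorem isClosed_polar (M : PointedCone ℝ (Fin n → ℝ)) :
    IsClosed (polar M : Set (Fin n → ℝ)) := by
  have : (polar M : Set (Fin n → ℝ)) = ⋂ m ∈ M, {p | 0 ≤ m ⬝ᵥ p} := by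
    ext p; simp [polar]
  rw [this]
  exact isClosed_biInter fun m _ =>
    isClosed_le continuous_const (continuous_const.dotProduct continuous_id)

theorem isClosed_adjointOn (K : PointedCone ℝ ((Fin n → ℝ) × (Fin n → ℝ)))
    (M : PointedCone ℝ (Fin n → ℝ)) :
    IsClosed (adjointOn K M : Set ((Fin n → ℝ) × (Fin n → ℝ))) := by
  have : (adjointOn K M : Set ((Fin n → ℝ) × (Fin n → ℝ))) =
      (Prod.fst ⁻¹' (polar M : Set (Fin n → ℝ)) ∩ Prod.snd ⁻¹' (polar M : Set (Fin n → ℝ))) ∩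
        ⋂ z ∈ K, {x | z.2 ⬝ᵥ x.2 ≤ z.1 ⬝ᵥ x.1} := by
    ext x
    simp [adjointOn, and_assoc]
  rw [this]
  exact (((isClosed_polar M).preimage continuous_fst).inter
    ((isClosed_polar M).preimage continuous_snd)).inter (isClosed_biInter fun z _ =>
      isClosed_le (continuous_const.dotProduct continuous_snd)
        (continuous_const.dotProduct continuous_fst))

/-- If `M` is backward invariant under the convex process with graph `K`, and the image of the
process meets every coset of the lineality space of `M`, then every element of the polar cone of
`M` is an adjoint image of another one. -/
theorem exists_mem_adjointOn {K : PointedCone ℝ ((Fin n → ℝ) × (Fin n → ℝ))}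
    {M : PointedCone ℝ (Fin n → ℝ)} (hMK : ∀ x y, (x, y) ∈ K → y ∈ M → x ∈ M)
    (him : ∀ v, ∃ x y, (x, y) ∈ K ∧ v - y ∈ M ∧ y - v ∈ M) {p : Fin n → ℝ} (hp : p ∈ polar M) :
    ∃ q, (p, q) ∈ adjointOn K M := by
  -- `S = K + {0} × (-M)`. The functional `(x, 0) ↦ x ⬝ᵥ p` is nonnegative on `S`: `(x, 0) ∈ S`
  -- means `(x, m) ∈ K` with `m ∈ M`, so `x ∈ M`. A nonnegative extension has the form `x ⬝ᵥ p - y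
  -- ⬝ᵥ q`.
  let S : PointedCone ℝ ((Fin n → ℝ) × (Fin n → ℝ)) :=
    K ⊔ M.map (-(LinearMap.inr ℝ (Fin n → ℝ) (Fin n → ℝ)))
  have hKS : ∀ z ∈ K, z ∈ S := fun z hz => Submodule.mem_sup_left hz
  have hMS : ∀ m ∈ M, ((0 : Fin n → ℝ), -m) ∈ S := fun m hm =>
    Submodule.mem_sup_right ⟨m, hm, by ext <;> simp⟩
  let i : (Fin n → ℝ) →ₗ[ℝ] (Fin n → ℝ) × (Fin n → ℝ) := LinearMap.inl ℝ _ _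
  let f : ((Fin n → ℝ) × (Fin n → ℝ)) →ₗ[ℝ] ℝ :=
    (dotProductEquiv ℝ (Fin n) p).comp (LinearMap.fst ℝ _ _)
  have hf : ∀ z, f z = z.1 ⬝ᵥ p := fun z => by simp [f, dotProduct_comm]
  obtain ⟨g, hg, hgS⟩ := riesz_extension S ⟨LinearMap.range i, f.domRestrict _⟩ (by
    rintro ⟨_, ⟨x, rfl⟩⟩ hx
    change 0 ≤ f (i x)
    rw [hf]
    obtain ⟨k, hk, _, ⟨m, hm, rfl⟩, hkm⟩ := Submodule.mem_sup.1 hx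
    obtain ⟨a, b⟩ := k
    have h1 := congrArg Prod.fst hkm
    have h2 := congrArg Prod.snd hkm
    simp [i] at h1 h2
    have : b = m := by rwa [← sub_eq_add_neg, sub_eq_zero] at h2
    subst this
    subst h1
    exact hp _ (hMK _ _ hk hm)) (by
    rintro ⟨u, v⟩
    obtain ⟨x, y, hxy, -, h⟩ := him v
    refine ⟨⟨i (x - u), ⟨_, rfl⟩⟩, ?_⟩
    have := Submodule.add_mem S (hKS _ hxy) (hMS _ h)
    simpa [i] using this)
  have hgi : ∀ x, g (x, 0) = x ⬝ᵥ p := fun x => by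
    have := hg ⟨i x, ⟨x, rfl⟩⟩
    exact this.trans (hf _)
  obtain ⟨q, hq⟩ := (dotProductEquiv ℝ (Fin n)).surjective (-(g.comp (LinearMap.inr ℝ _ _)))
  have hgq : ∀ y, g (0, y) = - (y ⬝ᵥ q) := fun y => by
    have := LinearMap.congr_fun hq y
    simp at this
    rw [dotProduct_comm, this]; simp
  have hgg : ∀ x y, g (x, y) = x ⬝ᵥ p - y ⬝ᵥ q := fun x y => by
    rw [← hgi, sub_eq_add_neg, ← hgq, ← map_add]; simp
  refine ⟨q, mem_adjointOn.2 ⟨hp, fun m hm => ?_, fun x y hxy => ?_⟩⟩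
  · have := hgS _ (hMS m hm)
    rw [hgg] at this
    simpa using this
  · have := hgS _ (hKS _ hxy)
    rw [hgg] at this
    linarith

theorem dotProduct_self_nonneg (v : Fin n → ℝ) : 0 ≤ v ⬝ᵥ v :=
  Finset.sum_nonneg fun _ _ => mul_self_nonneg _

theorem dotProduct_eq_zero_of_mem_polar {M : PointedCone ℝ (Fin n → ℝ)} {p m : Fin n → ℝ}
    (hp : p ∈ polar M) (h1 : m ∈ M) (h2 : -m ∈ M) : m ⬝ᵥ p = 0 := by
  have h3 := hp _ h1
  have h4 := hp _ h2
  rw [neg_dotProduct] at h4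
  linarith

/-- A backward invariant convex cone `M` of a convex process is the whole space, if the domain and
the image of the process meet every coset of the lineality space of `M`, the linear hull of the
process is reachable, and the adjoint process has no eigenvector with positive eigenvalue. -/
theorem eq_top_of_backwardInvariant {K : PointedCone ℝ ((Fin n → ℝ) × (Fin n → ℝ))}
    {M : PointedCone ℝ (Fin n → ℝ)} (hMK : ∀ x y, (x, y) ∈ K → y ∈ M → x ∈ M)
    (hdom : ∀ v, ∃ x y, (x, y) ∈ K ∧ v - x ∈ M ∧ x - v ∈ M)
    (him : ∀ v, ∃ x y, (x, y) ∈ K ∧ v - y ∈ M ∧ y - v ∈ M)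
    (hreach : ∀ U : Submodule ℝ (Fin n → ℝ),
      (∀ x y, (x, y) ∈ Submodule.span ℝ (K : Set ((Fin n → ℝ) × (Fin n → ℝ))) → x ∈ U → y ∈ U) →
        U = ⊤)
    (hdual : ∀ lam : ℝ, 0 < lam → ∀ ξ : Fin n → ℝ,
      (∀ x y, (x, y) ∈ K → y ⬝ᵥ ξ ≤ lam * (x ⬝ᵥ ξ)) → ξ = 0) :
    M = ⊤ := by
  have hex : ∀ p ∈ polar M, ∃ q, (p, q) ∈ adjointOn K M :=
    fun p hp => exists_mem_adjointOn hMK him hp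
  have hzero_left : ∀ q, (0, q) ∈ adjointOn K M → q = 0 := by
    intro q hq
    obtain ⟨-, hqP, hqK⟩ := mem_adjointOn.1 hq
    -- Elements of the polar vanish on the lineality space of `M`, so `v` may be replaced by `y`.
    have hle : ∀ v, v ⬝ᵥ q ≤ 0 := fun v => by
      obtain ⟨x, y, hxy, h1, h2⟩ := him v
      have h3 := dotProduct_eq_zero_of_mem_polar hqP h1 (by rwa [neg_sub])
      have h4 := hqK x y hxy
      rw [sub_dotProduct] at h3
      rw [dotProduct_zero] at h4
      linarith
    exact dotProduct_self_eq_zero.1 (le_antisymm (hle q) (dotProduct_self_nonneg q))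
  have hzero_right : ∀ p, (p, 0) ∈ adjointOn K M → p = 0 := by
    intro p hp
    obtain ⟨hpP, -, hpK⟩ := mem_adjointOn.1 hp
    have hge : ∀ v, 0 ≤ v ⬝ᵥ p := fun v => by
      obtain ⟨x, y, hxy, h1, h2⟩ := hdom v
      have h3 := dotProduct_eq_zero_of_mem_polar hpP h1 (by rwa [neg_sub])
      have h4 := hpK x y hxy
      rw [sub_dotProduct] at h3
      rw [dotProduct_zero] at h4
      linarith
    refine dotProduct_self_eq_zero.1 (le_antisymm ?_ (dotProduct_self_nonneg p))
    have := hge (-p)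
    rw [neg_dotProduct] at this
    linarith
  -- the annihilator of `M` is trivial
  let A : Submodule ℝ (Fin n → ℝ) :=
    { carrier := {p | ∀ m ∈ M, m ⬝ᵥ p = 0}
      zero_mem' := by simp
      add_mem' := fun hp hq m hm => by rw [dotProduct_add, hp m hm, hq m hm, add_zero]
      smul_mem' := fun c p hp m hm => by rw [dotProduct_smul, hp m hm, smul_zero] }
  have hAP : ∀ p ∈ A, p ∈ polar M := fun p hp m hm => (hp m hm).ge
  have hPA : ∀ p, p ∈ polar M → -p ∈ polar M → p ∈ A := fun p h1 h2 m hm => by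
    have h3 := h1 m hm
    have h4 := h2 m hm
    rw [dotProduct_neg] at h4
    linarith
  let B : Submodule ℝ ((Fin n → ℝ) × (Fin n → ℝ)) :=
    { carrier := {z | z.1 ∈ A ∧ z.2 ∈ A ∧ ∀ x y, (x, y) ∈ K → x ⬝ᵥ z.1 = y ⬝ᵥ z.2}
      zero_mem' := ⟨A.zero_mem, A.zero_mem, by simp⟩
      add_mem' := fun hz hw => ⟨A.add_mem hz.1 hw.1, A.add_mem hz.2.1 hw.2.1, fun x y h => by
        simp only [Prod.fst_add, Prod.snd_add, dotProduct_add, hz.2.2 x y h, hw.2.2 x y h]⟩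
      smul_mem' := fun c z hz => ⟨A.smul_mem c hz.1, A.smul_mem c hz.2.1, fun x y h => by
        simp only [Prod.smul_fst, Prod.smul_snd, dotProduct_smul, hz.2.2 x y h]⟩ }
  have hBadj : ∀ z ∈ B, z ∈ adjointOn K M := fun z hz =>
    ⟨hAP _ hz.1, hAP _ hz.2.1, fun w hw => (hz.2.2 w.1 w.2 hw).ge⟩
  have hAB : ∀ p ∈ A, ∃ q, (p, q) ∈ B := by
    intro p hp
    obtain ⟨q, hq⟩ := hex p (hAP p hp)
    obtain ⟨q', hq'⟩ := hex (-p) (hAP _ (A.neg_mem hp))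
    -- By additivity `q + q'` is an adjoint image of `p + (-p) = 0`.
    have hqq : q + q' = 0 := by
      apply hzero_left
      have := Submodule.add_mem _ hq hq'
      simpa using this
    obtain rfl : q' = -q := (neg_eq_of_add_eq_zero_right hqq).symm
    obtain ⟨-, hqP, hqK⟩ := mem_adjointOn.1 hq
    obtain ⟨-, hqP', hqK'⟩ := mem_adjointOn.1 hq'
    refine ⟨q, hp, hPA q hqP hqP', fun x y h => ?_⟩
    have h1 := hqK x y h
    have h2 := hqK' x y h
    rw [dotProduct_neg, dotProduct_neg] at h2
    exact le_antisymm (by linarith) h1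
  -- `B` projects onto `A` in the first coordinate and injects into `A` in the second, so the second
  -- projection is onto by dimension.
  have hBA : ∀ q ∈ A, ∃ p, (p, q) ∈ B := by
    have hfst : B.map (LinearMap.fst ℝ _ _) = A := by
      apply le_antisymm
      · rintro _ ⟨z, hz, rfl⟩; exact hz.1
      · intro p hp
        obtain ⟨q, hq⟩ := hAB p hp
        exact ⟨_, hq, rfl⟩
    have hsnd : B.map (LinearMap.snd ℝ _ _) ≤ A := by
      rintro _ ⟨z, hz, rfl⟩; exact hz.2.1
    have hinj : Function.Injective ((LinearMap.snd ℝ (Fin n → ℝ) (Fin n → ℝ)).domRestrict B) := by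
      rw [← LinearMap.ker_eq_bot, LinearMap.ker_eq_bot']
      rintro ⟨⟨p, q⟩, hz⟩ h
      obtain rfl : q = 0 := h
      have := hzero_right p (hBadj _ hz)
      subst this
      rfl
    have hrank : Module.finrank ℝ A ≤ Module.finrank ℝ (B.map (LinearMap.snd ℝ _ _)) := by
      rw [← LinearMap.range_domRestrict, LinearMap.finrank_range_of_inj hinj, ← hfst]
      exact Submodule.finrank_map_le _ _
    have heq := Submodule.eq_of_le_of_finrank_le hsnd hrank
    intro q hq
    rw [← heq] at hq
    obtain ⟨⟨p, q⟩, hz, rfl⟩ := hq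
    exact ⟨p, hz⟩
  have hspan : ∀ z ∈ Submodule.span ℝ (K : Set ((Fin n → ℝ) × (Fin n → ℝ))),
      ∀ w ∈ B, z.1 ⬝ᵥ w.1 = z.2 ⬝ᵥ w.2 := by
    intro z hz w hw
    induction hz using Submodule.span_induction with
    | mem z hz => exact hw.2.2 _ _ hz
    | zero => simp
    | add x y _ _ hx hy => simp [add_dotProduct, hx, hy]
    | smul c x _ hx => simp [smul_dotProduct, hx]
  have hAtriv : ∀ p ∈ A, p = 0 := by
    let U : Submodule ℝ (Fin n → ℝ) :=
      { carrier := {x | ∀ q ∈ A, x ⬝ᵥ q = 0}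
        zero_mem' := by simp
        add_mem' := fun hx hy q hq => by rw [add_dotProduct, hx q hq, hy q hq, add_zero]
        smul_mem' := fun c x hx q hq => by rw [smul_dotProduct, hx q hq, smul_zero] }
    -- Invariance of `U`: for `q ∈ A` choose `p ∈ A` with `(p, q) ∈ B`; then `y ⬝ᵥ q = x ⬝ᵥ p = 0`.
    have hU : U = ⊤ := hreach U fun x y hxy hx q hq => by
      obtain ⟨p, hpq⟩ := hBA q hq
      rw [← hspan _ hxy _ hpq]
      exact hx p hpq.1
    intro p hp
    have : p ∈ U := by rw [hU]; trivial
    exact dotProduct_self_eq_zero.1 (this p hp)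
  have hMspan : Submodule.span ℝ (M : Set (Fin n → ℝ)) = ⊤ := by
    by_contra hne
    obtain ⟨f, hf0, hf⟩ := Submodule.exists_le_ker_of_lt_top _ (lt_top_iff_ne_top.2 hne)
    obtain ⟨p, rfl⟩ := (dotProductEquiv ℝ (Fin n)).surjective f
    apply hf0
    rw [hAtriv p fun m hm => ?_, map_zero]
    have := hf (Submodule.subset_span hm)
    rw [LinearMap.mem_ker] at this
    rw [dotProduct_comm]
    simpa using this
  obtain ⟨e, heM, he⟩ := exists_orderUnit M
  rw [hMspan] at he
  by_cases hneg : -e ∈ M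
  · rw [eq_top_iff]
    intro x _
    obtain ⟨δ, hδ, h⟩ := he x trivial
    have := Submodule.add_mem M h hneg
    rw [add_neg_cancel_comm] at this
    exact (PointedCone.smul_mem_iff M hδ).1 this
  exfalso
  obtain ⟨g, hgM, hge⟩ := exists_nonneg_functional M heM (fun x => he x trivial) hneg
  obtain ⟨p₀, rfl⟩ := (dotProductEquiv ℝ (Fin n)).surjective g
  have hp₀ : p₀ ∈ polar M := fun m hm => by
    have := hgM m hm
    rw [dotProduct_comm]
    simpa using this
  have hp₀0 : p₀ ≠ 0 := by rintro rfl; simp at hge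
  have hφ : ∀ p ∈ polar M, p ≠ 0 → 0 < dotProductEquiv ℝ (Fin n) e p := by
    intro p hp hp0
    have h1 : 0 ≤ e ⬝ᵥ p := hp e heM
    rw [dotProductEquiv_apply_apply]
    refine lt_of_le_of_ne h1 fun h2 => hp0 ?_
    -- If `e ⬝ᵥ p = 0`, testing `p` on `e - δ • p ∈ M` gives `p ⬝ᵥ p ≤ 0`.
    obtain ⟨δ, hδ, h⟩ := he (-p) trivial
    have h3 := hp _ h
    rw [add_dotProduct, ← h2, smul_dotProduct, neg_dotProduct, smul_eq_mul] at h3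
    have h4 := dotProduct_self_nonneg p
    refine dotProduct_self_eq_zero.1 (le_antisymm ?_ h4)
    nlinarith
  obtain ⟨p, hp, hp0, μ, hμ, hpμ⟩ := exists_eigenvector (polar M) (isClosed_polar M)
    (dotProductEquiv ℝ (Fin n) e) hφ (adjointOn K M) (isClosed_adjointOn K M)
    (fun p q h => ⟨h.1, h.2.1⟩) hex hzero_left ⟨p₀, hp₀, hp₀0⟩
  rcases hμ.eq_or_lt with rfl | hμ
  · rw [zero_smul] at hpμ
    exact hp0 (hzero_right p hpμ)
  · refine hp0 (hdual μ⁻¹ (inv_pos.2 hμ) p fun x y hxy => ?_)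
    have := (mem_adjointOn.1 hpμ).2.2 x y hxy
    rw [dotProduct_smul, smul_eq_mul] at this
    rwa [le_inv_mul_iff₀ hμ]

end ConvProc

/-! ### Reachable subspaces of a linear relation -/

namespace ConvProc

variable {n : ℕ}

/-- The points that trajectories of length `k` of the linear relation `L` reach from the origin. -/
def reachable (L : Submodule ℝ ((Fin n → ℝ) × (Fin n → ℝ))) : ℕ → Submodule ℝ (Fin n → ℝ)
  | 0 => ⊥
  | k + 1 => (L ⊓ (reachable L k).comap (LinearMap.fst ℝ _ _)).map (LinearMap.snd ℝ _ _)

theorem mem_reachable_succ {L : Submodule ℝ ((Fin n → ℝ) × (Fin n → ℝ))} {k : ℕ}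
    {y : Fin n → ℝ} : y ∈ reachable L (k + 1) ↔ ∃ x ∈ reachable L k, (x, y) ∈ L := by
  constructor
  · rintro ⟨⟨x, y⟩, ⟨h1, h2⟩, rfl⟩
    exact ⟨x, h2, h1⟩
  · rintro ⟨x, h1, h2⟩
    exact ⟨(x, y), ⟨h2, h1⟩, rfl⟩

theorem reachable_le_succ (L : Submodule ℝ ((Fin n → ℝ) × (Fin n → ℝ))) (k : ℕ) :
    reachable L k ≤ reachable L (k + 1) := by
  induction k with
  | zero => exact bot_le
  | succ k ih =>
    intro y hy
    obtain ⟨x, hx, hxy⟩ := mem_reachable_succ.1 hy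
    exact mem_reachable_succ.2 ⟨x, ih hx, hxy⟩

/-- The increasing chain is constant from its first repetition on; without one up to step `n` its
dimension would exceed `n`. -/
theorem reachable_succ_dim (L : Submodule ℝ ((Fin n → ℝ) × (Fin n → ℝ))) :
    reachable L (n + 1) = reachable L n := by
  have hstab : ∀ k, reachable L (k + 1) = reachable L k →
      ∀ m, k ≤ m → reachable L (m + 1) = reachable L m := by
    intro k hk m hm
    induction m, hm using Nat.le_induction with
    | base => exact hk
    | succ m _ ih =>
      ext y
      rw [mem_reachable_succ, mem_reachable_succ, ih]
  by_contra hne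
  have hrank : ∀ k, k ≤ n + 1 → k ≤ Module.finrank ℝ (reachable L k) := by
    intro k
    induction k with
    | zero => simp
    | succ k ih =>
      intro hk
      have hlt : reachable L k < reachable L (k + 1) :=
        lt_of_le_of_ne (reachable_le_succ L k) fun h => hne (hstab k h.symm n (by omega))
      have := Submodule.finrank_lt_finrank_of_lt hlt
      have := ih (by omega)
      omega
  have h1 := hrank (n + 1) le_rfl
  have h2 := (reachable L (n + 1)).finrank_le
  rw [Module.finrank_fin_fun] at h2
  omega

/-! ### The null-controllable cone of a convex process -/

namespace SetValuedMap

variable {H : SetValuedMap n}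

/-- The graph of a convex process as a pointed cone. -/
def graphCone (H : SetValuedMap n) (hH : H.IsConvexProc) :
    PointedCone ℝ ((Fin n → ℝ) × (Fin n → ℝ)) where
  carrier := H.graph
  zero_mem' := by
    obtain ⟨z, hz⟩ := hH.1
    simpa using hH.2.2 0 le_rfl z hz
  add_mem' {x y} hx hy := by
    have := hH.2.2 2 (by norm_num) _
      (hH.2.1 hx hy (show (0 : ℝ) ≤ 1 / 2 by norm_num) (show (0 : ℝ) ≤ 1 / 2 by norm_num)
        (by norm_num))
    have h2 : x + y = (2 : ℝ) • ((1 / 2 : ℝ) • x + (1 / 2 : ℝ) • y) := by module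
    rwa [h2]
  smul_mem' c x hx := hH.2.2 c c.2 x hx

theorem mem_graphCone (hH : H.IsConvexProc) {x y : Fin n → ℝ} :
    (x, y) ∈ H.graphCone hH ↔ y ∈ H x := Iff.rfl

/-- Padding with zeros turns finite trajectories into infinite ones, so that trajectories of
different lengths can be added. -/
theorem mem_nullControllableSet_iff (h0 : 0 ∈ H 0) {ξ : Fin n → ℝ} :
    ξ ∈ H.nullControllableSet ↔
      ∃ x ∈ H.behavior, x 0 = ξ ∧ ∃ q : ℕ, ∀ k, q ≤ k → x k = 0 := by
  constructor
  · rintro ⟨q, x, hx, rfl, hq⟩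
    refine ⟨fun k => if h : k < q + 1 then x ⟨k, h⟩ else 0, fun k => ?_, by simp, q, fun k hk => ?_⟩
    · dsimp only
      by_cases hk : k < q
      · rw [dif_pos (show k + 1 < q + 1 by omega), dif_pos (show k < q + 1 by omega)]
        exact hx ⟨k, hk⟩
      · rw [dif_neg (show ¬ k + 1 < q + 1 by omega)]
        split_ifs with h
        · have : (⟨k, h⟩ : Fin (q + 1)) = Fin.last q := Fin.ext (by simp; omega)
          rw [this, hq]; exact h0
        · exact h0
    · dsimp only
      split_ifs with h
      · have : (⟨k, h⟩ : Fin (q + 1)) = Fin.last q := Fin.ext (by simp; omega)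
        rw [this, hq]
      · rfl
  · rintro ⟨x, hx, rfl, q, hq⟩
    exact ⟨q, fun k => x k, fun k => hx k, rfl, hq _ (by simp)⟩

theorem mem_nullControllableSet_of_step (h0 : 0 ∈ H 0) {x y : Fin n → ℝ} (hxy : y ∈ H x)
    (hy : y ∈ H.nullControllableSet) : x ∈ H.nullControllableSet := by
  rw [mem_nullControllableSet_iff h0] at hy ⊢
  obtain ⟨z, hz, rfl, q, hq⟩ := hy
  refine ⟨fun k => Nat.casesOn k x z, fun k => ?_, rfl, q + 1, fun k hk => ?_⟩
  · cases k with
    | zero => exact hxy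
    | succ k => exact hz k
  · cases k with
    | zero => omega
    | succ k => exact hq k (by omega)

/-- The null-controllable set of a convex process as a pointed cone. -/
def nullControllableCone (H : SetValuedMap n) (hH : H.IsConvexProc) :
    PointedCone ℝ (Fin n → ℝ) where
  carrier := H.nullControllableSet
  zero_mem' := ⟨0, fun _ => 0, fun k => k.elim0, rfl, rfl⟩
  add_mem' {a b} ha hb := by
    have h0 : 0 ∈ H 0 := (H.graphCone hH).zero_mem
    rw [mem_nullControllableSet_iff h0] at ha hb ⊢
    obtain ⟨x, hx, rfl, q, hq⟩ := ha
    obtain ⟨y, hy, rfl, r, hr⟩ := hb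
    refine ⟨fun k => x k + y k, fun k => ?_, rfl, max q r, fun k hk => ?_⟩
    · exact (H.graphCone hH).add_mem (x := (x k, x (k + 1))) (y := (y k, y (k + 1))) (hx k) (hy k)
    · simp [hq k (le_of_max_le_left hk), hr k (le_of_max_le_right hk)]
  smul_mem' c a ha := by
    have h0 : 0 ∈ H 0 := (H.graphCone hH).zero_mem
    rw [mem_nullControllableSet_iff h0] at ha ⊢
    obtain ⟨x, hx, rfl, q, hq⟩ := ha
    refine ⟨fun k => c • x k, fun k => ?_, rfl, q, fun k hk => by simp [hq k hk]⟩
    exact PointedCone.smul_mem (H.graphCone hH) c.2 (x := (x k, x (k + 1))) (hx k)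

/-- A trajectory of `H` starts in the null-controllable set if it gets there up to a correction by a
trajectory of a linear subprocess that starts at the origin. -/
theorem mem_nullControllableSet_of_sub_reachable (hH : H.IsConvexProc)
    {L : Submodule ℝ ((Fin n → ℝ) × (Fin n → ℝ))} (hL : ∀ z ∈ L, z ∈ H.graphCone hH)
    {x : ℕ → Fin n → ℝ} (hx : x ∈ H.behavior) (k : ℕ) :
    ∀ r ∈ reachable L k, x k - r ∈ H.nullControllableSet → x 0 ∈ H.nullControllableSet := by
  induction k with
  | zero =>
    intro r hr h
    obtain rfl : r = 0 := hr
    simpa using h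
  | succ k ih =>
    intro r hr h
    -- Subtracting `(s, r) ∈ L` from `(x k, x (k + 1))` stays in the graph, so null-controllability
    -- passes back from `x (k + 1) - r` to `x k - s`.
    obtain ⟨s, hs, hsr⟩ := mem_reachable_succ.1 hr
    refine ih s hs (mem_nullControllableSet_of_step (H.graphCone hH).zero_mem ?_ h)
    have := (H.graphCone hH).add_mem (x := (x k, x (k + 1))) (hx k) (hL _ (L.neg_mem hsr))
    rw [← SetValuedMap.mem_graphCone hH]
    simpa [sub_eq_add_neg] using this

/-- A convex process is null-controllable if its null-controllable set and the reachable set of a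
linear subprocess together span the space. -/
theorem isNullControllable_of_sup_eq_top (hH : H.IsConvexProc)
    {L : Submodule ℝ ((Fin n → ℝ) × (Fin n → ℝ))} (hL : ∀ z ∈ L, z ∈ H.graphCone hH) {k : ℕ}
    (htop : H.nullControllableCone hH ⊔ (reachable L k : PointedCone ℝ (Fin n → ℝ)) = ⊤) :
    H.IsNullControllable := by
  rintro _ ⟨x, hx, rfl⟩
  have hmem : x k ∈ H.nullControllableCone hH ⊔
      (reachable L k : PointedCone ℝ (Fin n → ℝ)) := by rw [htop]; trivial
  obtain ⟨ν, hν, r, hr, hsum⟩ := Submodule.mem_sup.1 hmem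
  refine mem_nullControllableSet_of_sub_reachable hH hL hx k r hr ?_
  rw [← hsum, add_sub_cancel_right]
  exact hν

end SetValuedMap

/-! ### Necessity of the spectral condition -/

/-- A dual eigenvector with a positive eigenvalue yields a compatible convex process, with a half
space as its graph, that is not null-controllable. -/
theorem eq_zero_of_informative {D : Set ((Fin n → ℝ) × (Fin n → ℝ))}
    (hD : InformativeForNullControllability D) {lam : ℝ} (hlam : 0 < lam) {ξ : Fin n → ℝ}
    (hξ : ∀ z ∈ D, ξ ⬝ᵥ z.2 ≤ lam * (ξ ⬝ᵥ z.1)) : ξ = 0 := by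
  let H : SetValuedMap n := fun x => {y | ξ ⬝ᵥ y ≤ lam * (ξ ⬝ᵥ x)}
  have hmem : ∀ x y, y ∈ H x ↔ ξ ⬝ᵥ y ≤ lam * (ξ ⬝ᵥ x) := fun _ _ => Iff.rfl
  have hg : ∀ z, z ∈ H.graph ↔ ξ ⬝ᵥ z.2 ≤ lam * (ξ ⬝ᵥ z.1) := fun _ => Iff.rfl
  have hconv : H.IsConvexProc := by
    refine ⟨⟨0, by simp [hg]⟩, ?_, ?_⟩
    · intro x hx y hy a b ha hb _
      rw [hg] at hx hy ⊢
      simp only [Prod.fst_add, Prod.snd_add, Prod.smul_fst, Prod.smul_snd, dotProduct_add,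
        dotProduct_smul, smul_eq_mul]
      nlinarith [mul_le_mul_of_nonneg_left hx ha, mul_le_mul_of_nonneg_left hy hb]
    · intro ρ hρ c hc
      rw [hg] at hc ⊢
      simp only [Prod.smul_fst, Prod.smul_snd, dotProduct_smul, smul_eq_mul]
      nlinarith [mul_le_mul_of_nonneg_left hc hρ]
  have hfeas : -ξ ∈ H.feasibleSet := by
    refine ⟨fun k => lam ^ k • (-ξ), fun k => ?_, by simp⟩
    rw [hmem, dotProduct_smul, dotProduct_smul, pow_succ', smul_eq_mul, smul_eq_mul, mul_assoc]
  obtain ⟨x, hx, hx0, q, hq⟩ := (SetValuedMap.mem_nullControllableSet_iff (by simp [hmem])).1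
    (hD H hconv (fun z hz => hξ z hz) hfeas)
  by_contra hne
  have hpos : 0 < ξ ⬝ᵥ ξ := lt_of_le_of_ne (dotProduct_self_nonneg ξ)
    fun h => hne (dotProduct_self_eq_zero.1 h.symm)
  have hneg : ∀ k, ξ ⬝ᵥ x k < 0 := by
    intro k
    induction k with
    | zero => rw [hx0, dotProduct_neg]; linarith
    | succ k ih => exact lt_of_le_of_lt ((hmem _ _).1 (hx k)) (mul_neg_of_pos_of_neg hlam ih)
  have := hneg q
  rw [hq q le_rfl] at this
  simp at this

/-! ### Sufficiency of the spectral condition -/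

/-- The kernel relation of the generators of the polar cone is contained in the conic hull of the
data. -/
theorem mem_hull_of_kernel {T l : ℕ} {d : Fin T → (Fin n → ℝ) × (Fin n → ℝ)}
    {Z W : Matrix (Fin l) (Fin n) ℝ}
    (hZW : positivePolar (Set.range d) = cone (Set.range fun i => (Z.row i, -W.row i)))
    {x y : Fin n → ℝ} (hxy : Z *ᵥ x = W *ᵥ y) :
    (x, y) ∈ PointedCone.hull ℝ (Set.range d) := by
  -- `(x, y)` is orthogonal to every generator, hence to the whole polar, while a Farkas separator
  -- would be a polar element negative at `(x, y)`.
  have hz : ∀ η ∈ positivePolar (Set.range d), x ⬝ᵥ η.1 + y ⬝ᵥ η.2 = 0 := by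
    intro η hη
    rw [hZW] at hη
    change η ∈ PointedCone.hull ℝ _ at hη
    induction hη using Submodule.span_induction with
    | mem η h =>
      obtain ⟨i, rfl⟩ := h
      have : Z.row i ⬝ᵥ x = W.row i ⬝ᵥ y := congrFun hxy i
      simp only [dotProduct_neg]
      rw [dotProduct_comm x, this, dotProduct_comm y, add_neg_cancel]
    | zero => simp
    | add a b _ _ ha hb =>
      simp only [Prod.fst_add, Prod.snd_add, dotProduct_add]
      linarith
    | smul c a _ ha =>
      change x ⬝ᵥ ((c : ℝ) • a.1) + y ⬝ᵥ ((c : ℝ) • a.2) = 0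
      rw [dotProduct_smul, dotProduct_smul, ← smul_add, ha, smul_zero]
  rcases mem_hull_or_exists_separating Finset.univ d (x, y) with h | ⟨f, hf, hfv⟩
  · simpa using h
  exfalso
  obtain ⟨p, hp⟩ := (dotProductEquiv ℝ (Fin n)).surjective (f ∘ₗ LinearMap.inl ℝ _ _)
  obtain ⟨q, hq⟩ := (dotProductEquiv ℝ (Fin n)).surjective (f ∘ₗ LinearMap.inr ℝ _ _)
  have hfpq : ∀ a b, f (a, b) = a ⬝ᵥ p + b ⬝ᵥ q := fun a b => by
    have h1 := LinearMap.congr_fun hp a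
    have h2 := LinearMap.congr_fun hq b
    simp only [dotProductEquiv_apply_apply, LinearMap.comp_apply, LinearMap.inl_apply,
      LinearMap.inr_apply] at h1 h2
    rw [dotProduct_comm a, dotProduct_comm b, h1, h2, ← map_add]
    simp
  have := hz (p, q) (by
    rintro _ ⟨t, rfl⟩
    rw [← hfpq]
    exact hf t (Finset.mem_univ t))
  rw [hfpq] at hfv
  linarith

theorem mulVec_prod_eq_sum {T : ℕ} (X Y : Matrix (Fin n) (Fin T) ℝ) (w : Fin T → ℝ) :
    (X *ᵥ w, Y *ᵥ w) = ∑ t, w t • (X.col t, Y.col t) := by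
  have h : ∀ A : Matrix (Fin n) (Fin T) ℝ, A *ᵥ w = ∑ t, w t • A.col t := fun A => by
    ext i
    simp [Matrix.mulVec, dotProduct, Matrix.col_apply, mul_comm]
  rw [h, h]
  ext i <;> simp [Prod.fst_sum, Prod.snd_sum]

/-- The spectral condition suffices for every compatible convex process to be null-controllable. -/
theorem isNullControllable_of_spectral {T l : ℕ} {X Y : Matrix (Fin n) (Fin T) ℝ}
    {Z W : Matrix (Fin l) (Fin n) ℝ}
    (hZW : positivePolar (Set.range fun t => (X.col t, Y.col t)) =
      cone (Set.range fun i => (Z.row i, -W.row i)))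
    (hdom : image X (nonnegOrthant T) + (fun S => preimage W (image Z S))^[n] {0} = Set.univ)
    (hreach : (fun S => image Y (preimage X S))^[n] {0} = Set.univ)
    (him : image Y (nonnegOrthant T) + (fun S => preimage Z (image W S))^[n] {0} = Set.univ)
    (hspec : ∀ lam : ℝ, 0 < lam → ∀ ξ : Fin n → ℝ,
      (∀ t, ξ ⬝ᵥ Y.col t ≤ lam * (ξ ⬝ᵥ X.col t)) → ξ = 0)
    {H : SetValuedMap n} (hH : H.IsConvexProc)
    (hD : ∀ t, (X.col t, Y.col t) ∈ H.graphCone hH) : H.IsNullControllable := by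
  let L : Submodule ℝ ((Fin n → ℝ) × (Fin n → ℝ)) := LinearMap.ker
    (Z.mulVecLin ∘ₗ LinearMap.fst ℝ _ _ - W.mulVecLin ∘ₗ LinearMap.snd ℝ _ _)
  have hLmem : ∀ x y, (x, y) ∈ L ↔ Z *ᵥ x = W *ᵥ y := fun x y => by
    simp [L, sub_eq_zero]
  have hL : ∀ z ∈ L, z ∈ H.graphCone hH := by
    rintro ⟨x, y⟩ hz
    refine Submodule.span_le.2 ?_ (mem_hull_of_kernel hZW ((hLmem x y).1 hz))
    rintro _ ⟨t, rfl⟩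
    exact hD t
  have hcone : ∀ w ∈ nonnegOrthant T, (X *ᵥ w, Y *ᵥ w) ∈ H.graphCone hH := fun w hw => by
    rw [mulVec_prod_eq_sum]
    exact Submodule.sum_mem _ fun t _ => PointedCone.smul_mem _ (hw t) (hD t)
  have hiter : ∀ k, (fun S => preimage W (image Z S))^[k] {0} =
      (reachable L k : Set (Fin n → ℝ)) := by
    intro k
    induction k with
    | zero => rfl
    | succ k ih =>
      rw [Function.iterate_succ_apply', ih]
      ext y
      rw [SetLike.mem_coe, mem_reachable_succ]
      exact exists_congr fun x => and_congr_right fun _ => (hLmem x y).symm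
  set M : PointedCone ℝ (Fin n → ℝ) :=
    H.nullControllableCone hH ⊔ (reachable L n : PointedCone ℝ (Fin n → ℝ)) with hM
  have hRM : ∀ r ∈ reachable L n, r ∈ M := fun r hr => Submodule.mem_sup_right hr
  have hMK : ∀ x y, (x, y) ∈ H.graphCone hH → y ∈ M → x ∈ M := by
    intro x y hxy hy
    obtain ⟨ν, hν, r, hr, rfl⟩ := Submodule.mem_sup.1 hy
    change r ∈ reachable L n at hr
    -- Stabilisation after `n` steps provides an `L`-predecessor of `r` that is again in `reachable
    -- L n`.
    rw [← reachable_succ_dim] at hr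
    obtain ⟨s, hs, hsr⟩ := mem_reachable_succ.1 hr
    have hstep : (x - s, ν) ∈ H.graphCone hH := by
      have := Submodule.add_mem _ hxy (hL _ (L.neg_mem hsr))
      simpa [sub_eq_add_neg, add_assoc] using this
    rw [← sub_add_cancel x s]
    exact Submodule.add_mem _ (Submodule.mem_sup_left
      (SetValuedMap.mem_nullControllableSet_of_step (H.graphCone hH).zero_mem hstep hν)) (hRM s hs)
  -- The backward iterates of 0 under `L` are symmetric, so backward invariance puts them in the
  -- lineality space of `M`.
  have hback : ∀ k, ∀ v ∈ (fun S => preimage Z (image W S))^[k] {(0 : Fin n → ℝ)},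
      v ∈ M ∧ -v ∈ M := by
    intro k
    induction k with
    | zero =>
      rintro v rfl
      simp
    | succ k ih =>
      intro v hv
      rw [Function.iterate_succ_apply'] at hv
      obtain ⟨y, hy, hyv⟩ := hv
      have hvy : (v, y) ∈ L := (hLmem v y).2 hyv.symm
      exact ⟨hMK v y (hL _ hvy) (ih y hy).1, hMK (-v) (-y) (hL _ (L.neg_mem hvy)) (ih y hy).2⟩
  refine SetValuedMap.isNullControllable_of_sup_eq_top hH hL (k := n)
    (eq_top_of_backwardInvariant hMK ?_ ?_ ?_ ?_)
  · intro v
    have hv : v ∈ image X (nonnegOrthant T) +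
      (fun S => preimage W (image Z S))^[n] {0} := by rw [hdom]; trivial
    obtain ⟨_, ⟨w, hw, rfl⟩, r, hr, rfl⟩ := hv
    rw [hiter] at hr
    refine ⟨_, _, hcone w hw, ?_, ?_⟩
    · simpa using hRM r hr
    · simpa using hRM _ ((reachable L n).neg_mem hr)
  · intro v
    have hv : v ∈ image Y (nonnegOrthant T) +
      (fun S => preimage Z (image W S))^[n] {0} := by rw [him]; trivial
    obtain ⟨_, ⟨w, hw, rfl⟩, r, hr, rfl⟩ := hv
    refine ⟨_, _, hcone w hw, ?_, ?_⟩
    · simpa using (hback n r hr).1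
    · simpa using (hback n r hr).2
  · intro U hU
    -- `Y X⁻¹` allows coefficients of either sign, so its steps lie in the linear span of the graph,
    -- under which `U` is invariant.
    have hsub : ∀ k, ∀ v ∈ (fun S => image Y (preimage X S))^[k] {(0 : Fin n → ℝ)}, v ∈ U := by
      intro k
      induction k with
      | zero =>
        rintro v rfl
        exact U.zero_mem
      | succ k ih =>
        intro v hv
        rw [Function.iterate_succ_apply'] at hv
        obtain ⟨w, hw, rfl⟩ := hv
        refine hU (X *ᵥ w) _ ?_ (ih _ hw)
        dsimp only
        rw [mulVec_prod_eq_sum]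
        exact Submodule.sum_mem _ fun t _ => Submodule.smul_mem _ _ (Submodule.subset_span (hD t))
    rw [eq_top_iff]
    intro v _
    exact hsub n v (by rw [hreach]; trivial)
  · intro lam hlam ξ hξ
    refine hspec lam hlam ξ fun t => ?_
    rw [dotProduct_comm, dotProduct_comm ξ]
    exact hξ _ _ (hD t)

end ConvProc

theorem theorem6 {n T l : ℕ}
    (D : Finset ((Fin n → ℝ) × (Fin n → ℝ)))
    (X Y : Matrix (Fin n) (Fin T) ℝ)
    (hXY : (D : Set ((Fin n → ℝ) × (Fin n → ℝ))) = Set.range fun t => (X.col t, Y.col t))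
    (Z W : Matrix (Fin l) (Fin n) ℝ)
    (hZW : ConvProc.positivePolar (D : Set ((Fin n → ℝ) × (Fin n → ℝ))) =
      ConvProc.cone (Set.range fun i => (Z.row i, -W.row i)))
    (hdom : ConvProc.image X (ConvProc.nonnegOrthant T) +
      (fun S => ConvProc.preimage W (ConvProc.image Z S))^[n] {0} = Set.univ)
    (hreach : (fun S => ConvProc.image Y (ConvProc.preimage X S))^[n] {0} = Set.univ)
    (him : ConvProc.image Y (ConvProc.nonnegOrthant T) +
      (fun S => ConvProc.preimage Z (ConvProc.image W S))^[n] {0} = Set.univ) :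
    ConvProc.InformativeForNullControllability
        (D : Set ((Fin n → ℝ) × (Fin n → ℝ))) ↔
      ∀ lam : ℝ, 0 < lam → ∀ ξ : Fin n → ℝ,
        (∀ t, (ξ ᵥ* (Y - lam • X)) t ≤ 0) → ξ = 0 := by
  have hvec : ∀ (lam : ℝ) (ξ : Fin n → ℝ) (t : Fin T),
      (ξ ᵥ* (Y - lam • X)) t ≤ 0 ↔ ξ ⬝ᵥ Y.col t ≤ lam * (ξ ⬝ᵥ X.col t) := by
    intro lam ξ t
    have : (ξ ᵥ* (Y - lam • X)) t = ξ ⬝ᵥ Y.col t - lam * (ξ ⬝ᵥ X.col t) := by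
      rw [Matrix.vecMul_sub, Matrix.vecMul_smul]
      rfl
    rw [this, sub_nonpos]
  simp only [hvec]
  constructor
  · intro hinf lam hlam ξ hξ
    refine ConvProc.eq_zero_of_informative hinf hlam fun z hz => ?_
    rw [hXY] at hz
    obtain ⟨t, rfl⟩ := hz
    exact hξ t
  · intro hspec H hH hDH
    rw [hXY] at hZW hDH
    exact ConvProc.isNullControllable_of_spectral hZW hdom hreach him hspec hH
      fun t => hDH ⟨t, rfl⟩
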